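/- An infinitesimal noncommutative probability space $(\mathcal A,\varphi,\varphi')$ consists of a unital algebra $\mathcal A$ over $\mathbb C$ and linear functionals $\varphi,\varphi':\mathcal A\to\mathbb C$ with $\varphi(1_{\mathcal A})=1$ and $\varphi'(1_{\mathcal A})=0$. Unital subalgebras $\mathcal A_1,\dots,\mathcal A_k$ of $\mathcal A$ are infinitesimally free in $(\mathcal A,\varphi,\varphi')$ if, whenever $n\ge 1$, $i_1,\dots,i_n\in\{1,\dots,k\}$ satisfy $i_1\ne i_2,\ i_2\ne i_3,\dots,i_{n-1}\ne i_n$, and $a_1\in\mathcal A_{i_1},\dots,a_n\in\mathcal A_{i_n}$ satisfy $\varphi(a_1)=\dots=\varphi(a_n)=0$, one has $\varphi(a_1\cdots a_n)=0$ and $$\varphi'(a_1\cdots a_n)=\begin{cases}\varphi(a_1a_n)\,\varphi(a_2a_{n-1})\cdots\varphi(a_{(n-1)/2}\,a_{(n+3)/2})\cdot\varphi'(a_{(n+1)/2}) & \text{if } n \text{ is odd and } i_m=i_{n+1-m} \text{ for } 1\le m\le (n-1)/2,\\ 0 & \text{otherwise.}\end{cases}$$ Subsets $\mathcal X_1,\dots,\mathcal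 X_k$ of $\mathcal A$ are infinitesimally free if the unital subalgebras that they generate are. Let $(\mathcal A,\varphi,\varphi')$ be an infinitesimal noncommutative probability space, and let $p\in\mathcal A$ be an idempotent with $\varphi(p)\ne 0$. Put $\alpha=\varphi(p)$ and $\alpha'=\varphi'(p)$. Consider the compression $(\mathcal B,\psi,\psi')$, where $\mathcal B=p\mathcal Ap$ is the algebra with unit $p$, and $$\psi(b)=\frac1\alpha\,\varphi(b),\qquad \psi'(b)=\frac1\alpha\,\varphi'(b)-\frac{\alpha'}{\alpha^2}\,\varphi(b)\qquad(b\in\mathcal B);$$ this is again an infinitesimal noncommutative probability space. Let $\mathcal X_1,\dots,\mathcal X_k$ be subsets of $\mathcal A$ such that $\{p\},\mathcal X_1,\dots,\mathcal X_k$ are infinitesimally free in $(\mathcal A,\varphi,\varphi')$, and put $\mathcal Y_i=p\mathcal X_ip=\{pxp : x\in\mathcal X_i\}\subseteq\mathcal B$ for $1\le i\le k$. Then $\mathcal Y_1,\dots,\mathcal Y_k$ are infinitesimally free in $(\mathcal B,\psi,\psi')$. -/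

import Mathlib

/-- An infinitesimal noncommutative probability space (incps) on a unital algebra `A` over `ℂ`:
two linear functionals, the first one taking the value `1` at the unit, the second one the
value `0`. -/
structure Incps (A : Type*) [Ring A] [Algebra ℂ A] where
  φ : A →ₗ[ℂ] ℂ
  φ' : A →ₗ[ℂ] ℂ
  φ_one : φ 1 = 1
  φ'_one : φ' 1 = 0

namespace Incps

/-- Infinitesimal freeness of unital subalgebras `𝒜 0, …, 𝒜 (k-1)`. The factors are numbered
`a 0, …, a (n-1)`, so that the mirror image of the position `j` is `j.rev = n - 1 - j`, and the
middle position of an odd `n` is `n / 2 = (n - 1) / 2`. -/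
def InfFree {A : Type*} [Ring A] [Algebra ℂ A] (S : Incps A) {k : ℕ}
    (𝒜 : Fin k → Subalgebra ℂ A) : Prop :=
  ∀ (n : ℕ) (hn : 0 < n) (i : Fin n → Fin k) (a : Fin n → A),
    (∀ (j : ℕ) (hj : j + 1 < n), i ⟨j, Nat.lt_of_succ_lt hj⟩ ≠ i ⟨j + 1, hj⟩) →
    (∀ j, a j ∈ 𝒜 (i j)) →
    (∀ j, S.φ (a j) = 0) →
    S.φ (List.ofFn a).prod = 0 ∧
    S.φ' (List.ofFn a).prod =
      if Odd n ∧ ∀ j, i j = i j.rev then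
        (∏ j : Fin (n / 2),
          S.φ (a (Fin.castLE (Nat.div_le_self n 2) j) *
            a (Fin.castLE (Nat.div_le_self n 2) j).rev)) *
          S.φ' (a ⟨n / 2, Nat.div_lt_self hn one_lt_two⟩)
      else 0

/-- Infinitesimal freeness of arbitrary subsets: that of the unital subalgebras they generate. -/
def InfFreeSets {A : Type*} [Ring A] [Algebra ℂ A] (S : Incps A) {k : ℕ}
    (X : Fin k → Set A) : Prop :=
  S.InfFree fun j => Algebra.adjoin ℂ (X j)

section Compression

variable {A : Type*} [Ring A] [Algebra ℂ A] {p : A}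

/-- The corner `p A p` (Mathlib's ring with unit `p`) is a module over `ℂ`, with the scalar
multiplication of `A`. -/
noncomputable instance cornerModule (hp : IsIdempotentElem p) : Module ℂ hp.Corner where
  smul c b := ⟨c • b.1, by
    obtain ⟨x, hx⟩ := b.2
    exact ⟨c • x, by
      change p * (c • x) * p = c • b.1
      rw [← hx, mul_smul_comm, smul_mul_assoc]⟩⟩
  one_smul b := Subtype.ext (one_smul ℂ b.1)
  mul_smul c d b := Subtype.ext (mul_smul c d b.1)
  smul_zero c := Subtype.ext (smul_zero c)
  smul_add c b b' := Subtype.ext (smul_add c b.1 b'.1)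
  add_smul c d b := Subtype.ext (add_smul c d b.1)
  zero_smul b := Subtype.ext (zero_smul ℂ b.1)

/-- The corner `p A p` is a unital algebra over `ℂ`, with unit `p`. -/
noncomputable instance cornerAlgebra (hp : IsIdempotentElem p) : Algebra ℂ hp.Corner :=
  Algebra.ofModule
    (fun c b b' => Subtype.ext (smul_mul_assoc c b.1 b'.1))
    (fun c b b' => Subtype.ext (mul_smul_comm c b.1 b'.1))

/-- The inclusion of `p A p` into `A`, as a linear map. -/
noncomputable def cornerIncl (hp : IsIdempotentElem p) : hp.Corner →ₗ[ℂ] A where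
  toFun b := b.1
  map_add' _ _ := rfl
  map_smul' _ _ := rfl

/-- The element `p x p`, as an element of the corner `p A p`. -/
def compressElt (hp : IsIdempotentElem p) (x : A) : hp.Corner := ⟨p * x * p, x, rfl⟩

/-- The compression of an incps by an idempotent `p` with `φ p ≠ 0`: the algebra is `p A p`, and
`ψ b = φ b / α` and `ψ' b = φ' b / α - (α' / α ^ 2) φ b`, where `α = φ p` and `α' = φ' p`. -/
noncomputable def compression (S : Incps A) (hp : IsIdempotentElem p) (hα : S.φ p ≠ 0) :
    Incps hp.Corner where
  φ := (1 / S.φ p) • S.φ ∘ₗ cornerIncl hp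
  φ' := (1 / S.φ p) • S.φ' ∘ₗ cornerIncl hp
    - (S.φ' p / S.φ p ^ 2) • S.φ ∘ₗ cornerIncl hp
  φ_one := by
    change 1 / S.φ p * S.φ p = 1
    field_simp
  φ'_one := by
    change 1 / S.φ p * S.φ' p - S.φ' p / S.φ p ^ 2 * S.φ p = 0
    field_simp
    ring

end Compression

end Incps

/-! Infinitesimal freeness is freeness over the dual numbers: subalgebras `𝒜 i` are infinitesimally
free for `(φ, φ')` iff the `𝒜 i [ε]` are free for the `ℂ[ε]`-linear functional `φ + ε φ'`
(`InfFree.dual`, `InfFree.of_dual`). Indeed a centred `a` lifts to the centred `a - ε φ'(a)`, and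
the `ε`-part of an alternating product of lifts says that `φ'` of a word is `φ` of its `leibnizSum`.
Deleting one letter leaves two words, which `φ` pairs off outwards from the gap, so only the middle
letter of a mirror-symmetric word survives: this is the defining formula.

It remains to compress ordinary freeness over a commutative ring by a free idempotent `p` with `φ p`
a unit (`IsFreeFamily.compress`). Writing `p = φ p + p°`, centred elements of a corner become
combinations of `p w p` with `w` alternating; products keep this form, and `φ` kills it. Finally, `ψ
+ ε ψ'` is the restriction of `φ + ε φ'` divided by the unit `α + ε α'`, so both have the same
centred elements. -/

/-- `AltWord φ 𝒞 i j w`: the element `w` is a nonempty product of `φ`-centred letters from the sets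
`𝒞`, neighbouring letters having distinct indices, the first letter having the index `i` and the
last one the index `j`. -/
inductive AltWord {κ R B : Type*} [Zero R] [Mul B] (φ : B → R) (𝒞 : κ → Set B) :
    κ → κ → B → Prop
  | letter {i : κ} {a : B} : a ∈ 𝒞 i → φ a = 0 → AltWord φ 𝒞 i i a
  | cons {i j k : κ} {a w : B} : a ∈ 𝒞 i → φ a = 0 → i ≠ j → AltWord φ 𝒞 j k w →
      AltWord φ 𝒞 i k (a * w)

/-- Freeness of a family of sets: `φ` vanishes on all alternating products of centred elements. -/
def IsFreeFamily {κ R B : Type*} [Zero R] [Mul B] (φ : B → R) (𝒞 : κ → Set B) : Prop :=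
  ∀ ⦃i j w⦄, AltWord φ 𝒞 i j w → φ w = 0

theorem AltWord.mul {κ R B : Type*} [Zero R] [Semigroup B] {φ : B → R} {𝒞 : κ → Set B}
    {i j k l : κ} {v w : B} (hv : AltWord φ 𝒞 i j v) (hjk : j ≠ k) (hw : AltWord φ 𝒞 k l w) :
    AltWord φ 𝒞 i l (v * w) := by
  induction hv with
  | letter ha h0 => exact .cons ha h0 hjk hw
  | cons ha h0 hne _ ih => rw [mul_assoc]; exact .cons ha h0 hne (ih hjk)

/-! ### Compression of free algebras over a commutative ring. -/

section Compression

variable {κ R B : Type*} [CommRing R] [Ring B] [Algebra R B] (φ : B →ₗ[R] R)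

/-- The centred part `a - φ a` of an element. -/
def centred (a : B) : B := a - φ a • 1

variable {φ}

theorem map_centred (h1 : φ 1 = 1) (a : B) : φ (centred φ a) = 0 := by simp [centred, h1]

theorem centred_mem {C : Subalgebra R B} {a : B} (ha : a ∈ C) : centred φ a ∈ C :=
  sub_mem ha (C.smul_mem C.one_mem _)

/-- Alternating words `a₁ p° a₂ p° ⋯ p° aₘ` in centred letters of `C`, where `p°` is the centred
part of `p`. -/
inductive CornerWord (φ : B →ₗ[R] R) (p : B) (C : Subalgebra R B) : B → Prop
  | letter {a : B} : a ∈ C → φ a = 0 → CornerWord φ p C a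
  | cons {a w : B} : a ∈ C → φ a = 0 → CornerWord φ p C w →
      CornerWord φ p C (a * (centred φ p * w))

/-- The compression by `p` of the algebra generated by `p` and `C`, as a span of words. -/
def cornerSpan (φ : B →ₗ[R] R) (p : B) (C : Subalgebra R B) : Submodule R B :=
  Submodule.span R (insert p {x | ∃ w, CornerWord φ p C w ∧ x = p * w * p})

variable {p : B} {C : Subalgebra R B}

theorem self_mem_cornerSpan : p ∈ cornerSpan φ p C := Submodule.subset_span (.inl rfl)

theorem CornerWord.mem_cornerSpan {w : B} (hw : CornerWord φ p C w) :
    p * w * p ∈ cornerSpan φ p C :=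
  Submodule.subset_span (.inr ⟨w, hw, rfl⟩)

theorem mul_mul_mem_cornerSpan (h1 : φ 1 = 1) (hp : IsIdempotentElem p) {a : B} (ha : a ∈ C) :
    p * a * p ∈ cornerSpan φ p C := by
  have h : p * a * p = φ a • p + p * centred φ a * p := by
    simp [centred, mul_sub, sub_mul, hp.eq]
  rw [h]
  exact add_mem (Submodule.smul_mem _ _ self_mem_cornerSpan)
    (CornerWord.letter (centred_mem ha) (map_centred h1 a)).mem_cornerSpan

/-- The scalar part of `a` leaves `p p° w p`, and `p p° = (1 - φ p) p` shortens the word. -/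
theorem mul_centred_mul_mem_cornerSpan (h1 : φ 1 = 1) (hp : IsIdempotentElem p) {a w : B}
    (ha : a ∈ C) (hw : CornerWord φ p C w) :
    p * (a * (centred φ p * w)) * p ∈ cornerSpan φ p C := by
  have h : p * (a * (centred φ p * w)) * p = (φ a * (1 - φ p)) • (p * w * p) +
      p * (centred φ a * (centred φ p * w)) * p := by
    have hpp : ∀ x, p * (p * x) = p * x := fun x => by rw [← mul_assoc, hp.eq]
    simp only [centred, mul_sub, sub_mul, smul_mul_assoc, mul_smul_comm, mul_assoc, one_mul, hpp]
    module
  rw [h]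
  exact add_mem (Submodule.smul_mem _ _ hw.mem_cornerSpan)
    (CornerWord.cons (centred_mem ha) (map_centred h1 a) hw).mem_cornerSpan

theorem mul_word_mem_cornerSpan (h1 : φ 1 = 1) (hp : IsIdempotentElem p) {a w : B}
    (ha : a ∈ C) (hw : CornerWord φ p C w) : p * (a * w) * p ∈ cornerSpan φ p C := by
  cases hw with
  | letter hb _ => exact mul_mul_mem_cornerSpan h1 hp (mul_mem ha hb)
  | cons hb _ hw =>
    rw [← mul_assoc a]
    exact mul_centred_mul_mem_cornerSpan h1 hp (mul_mem ha hb) hw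

/-- The `p` between `a` and a word splits as `φ p + p°`: either `a` merges with the first letter, or
`p°` separates them. -/
theorem compress_mul_mem_cornerSpan (h1 : φ 1 = 1) (hp : IsIdempotentElem p) {a x : B}
    (ha : a ∈ C) (hx : x ∈ cornerSpan φ p C) : p * a * p * x ∈ cornerSpan φ p C := by
  have hpp : ∀ x, p * (p * x) = p * x := fun x => by rw [← mul_assoc, hp.eq]
  induction hx using Submodule.span_induction with
  | mem x hx =>
    rcases hx with rfl | ⟨w, hw, rfl⟩
    · rw [mul_assoc _ x x, hp.eq]
      exact mul_mul_mem_cornerSpan h1 hp ha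
    · have h : p * a * p * (p * w * p) =
          φ p • (p * (a * w) * p) + p * (a * (centred φ p * w)) * p := by
        simp only [centred, mul_sub, sub_mul, smul_mul_assoc, mul_smul_comm, mul_assoc, one_mul,
          hpp]
        module
      rw [h]
      exact add_mem (Submodule.smul_mem _ _ (mul_word_mem_cornerSpan h1 hp ha hw))
        (mul_centred_mul_mem_cornerSpan h1 hp ha hw)
  | zero => rw [mul_zero]; exact zero_mem _
  | add x y _ _ hx hy => rw [mul_add]; exact add_mem hx hy
  | smul c x _ hx => rw [mul_smul_comm]; exact Submodule.smul_mem _ _ hx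

theorem CornerWord.altWord {𝒞 : κ → Subalgebra R B} {o i : κ} (h1 : φ 1 = 1) (hpo : p ∈ 𝒞 o)
    (hi : i ≠ o) {w : B} (hw : CornerWord φ p (𝒞 i) w) :
    AltWord φ (fun i => (𝒞 i : Set B)) i i w := by
  induction hw with
  | letter ha h0 => exact .letter ha h0
  | cons ha h0 _ ih =>
    exact .cons ha h0 hi (.cons (centred_mem hpo) (map_centred h1 p) hi.symm ih)

/-- The span of the compressions `p w p` of the alternating words `w` from `i` to `j`. -/
def compressedWords (φ : B →ₗ[R] R) (p : B) (𝒞 : κ → Subalgebra R B) (i j : κ) : Submodule R B :=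
  Submodule.span R {x | ∃ w, AltWord φ (fun i => (𝒞 i : Set B)) i j w ∧ x = p * w * p}

variable {𝒞 : κ → Subalgebra R B} {o : κ}

/-- Splitting both outer `p` as `φ p + p°` gives four words, all alternating because `w` neither
begins nor ends in `𝒞 o`. -/
theorem map_compressed_altWord (h1 : φ 1 = 1) (hfree : IsFreeFamily φ fun i => (𝒞 i : Set B))
    (hpo : p ∈ 𝒞 o) {i j : κ} (hi : i ≠ o) (hj : j ≠ o) {w : B}
    (hw : AltWord φ (fun i => (𝒞 i : Set B)) i j w) : φ (p * w * p) = 0 := by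
  have hq : AltWord φ (fun i => (𝒞 i : Set B)) o o (centred φ p) :=
    .letter (centred_mem hpo) (map_centred h1 p)
  have h : p * w * p = (φ p * φ p) • w + φ p • (centred φ p * w) + φ p • (w * centred φ p) +
      centred φ p * w * centred φ p := by
    simp only [centred, mul_sub, sub_mul, smul_mul_assoc, mul_smul_comm, mul_assoc, one_mul,
      mul_one]
    module
  rw [h]
  simp [hfree hw, hfree (hq.mul hi.symm hw), hfree (hw.mul hj hq),
    hfree ((hq.mul hi.symm hw).mul hj hq)]

theorem map_compressedWords (h1 : φ 1 = 1) (hfree : IsFreeFamily φ fun i => (𝒞 i : Set B))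
    (hpo : p ∈ 𝒞 o) {i j : κ} (hi : i ≠ o) (hj : j ≠ o) {x : B}
    (hx : x ∈ compressedWords φ p 𝒞 i j) : φ x = 0 := by
  have : compressedWords φ p 𝒞 i j ≤ LinearMap.ker φ := by
    refine Submodule.span_le.2 ?_
    rintro _ ⟨w, hw, rfl⟩
    exact map_compressed_altWord h1 hfree hpo hi hj hw
  exact this hx

theorem mul_mem_compressedWords (h1 : φ 1 = 1) (hp : IsIdempotentElem p) (hpo : p ∈ 𝒞 o)
    {i j k l : κ} (hj : j ≠ o) (hk : k ≠ o) (hjk : j ≠ k) {x y : B}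
    (hx : x ∈ compressedWords φ p 𝒞 i j) (hy : y ∈ compressedWords φ p 𝒞 k l) :
    x * y ∈ compressedWords φ p 𝒞 i l := by
  have hpp : ∀ x, p * (p * x) = p * x := fun x => by rw [← mul_assoc, hp.eq]
  have hq : AltWord φ (fun i => (𝒞 i : Set B)) o o (centred φ p) :=
    .letter (centred_mem hpo) (map_centred h1 p)
  induction hx, hy using Submodule.span_induction₂ with
  | mem_mem x y hx hy =>
    obtain ⟨v, hv, rfl⟩ := hx
    obtain ⟨w, hw, rfl⟩ := hy
    have h : p * v * p * (p * w * p) = φ p • (p * (v * w) * p) +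
        p * (v * centred φ p * w) * p := by
      simp only [centred, mul_sub, sub_mul, smul_mul_assoc, mul_smul_comm, mul_assoc, mul_one, hpp]
      module
    rw [h]
    exact add_mem
      (Submodule.smul_mem _ _ (Submodule.subset_span ⟨_, hv.mul hjk hw, rfl⟩))
      (Submodule.subset_span ⟨_, (hv.mul hj hq).mul hk.symm hw, rfl⟩)
  | zero_left y _ => rw [zero_mul]; exact zero_mem _
  | zero_right x _ => rw [mul_zero]; exact zero_mem _
  | add_left x y z _ _ _ hx hy => rw [add_mul]; exact add_mem hx hy
  | add_right x y z _ _ _ hx hy => rw [mul_add]; exact add_mem hx hy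
  | smul_left c x y _ _ h => rw [smul_mul_assoc]; exact Submodule.smul_mem _ _ h
  | smul_right c x y _ _ h => rw [mul_smul_comm]; exact Submodule.smul_mem _ _ h

/-- In `c p + y` with `y` a combination of compressed words, `φ` sees only `c φ p`. Invertibility of
`φ p` is what forces `c = 0`, since `ℂ[ε]` has zero divisors. -/
theorem mem_compressedWords_of_map_eq_zero (h1 : φ 1 = 1)
    (hfree : IsFreeFamily φ fun i => (𝒞 i : Set B)) (hpo : p ∈ 𝒞 o) (hα : IsUnit (φ p)) {i : κ}
    (hi : i ≠ o) {x : B} (hx : x ∈ cornerSpan φ p (𝒞 i)) (h0 : φ x = 0) :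
    x ∈ compressedWords φ p 𝒞 i i := by
  obtain ⟨c, y, hy, rfl⟩ := Submodule.mem_span_insert.1 hx
  have hy' : y ∈ compressedWords φ p 𝒞 i i := by
    refine Submodule.span_mono ?_ hy
    rintro _ ⟨w, hw, rfl⟩
    exact ⟨w, hw.altWord h1 hpo hi, rfl⟩
  have hc : c * φ p = 0 := by
    simpa [map_compressedWords h1 hfree hpo hi hi hy'] using h0
  rw [hα.mul_left_eq_zero.1 hc, zero_smul, zero_add]
  exact hy'

/-- The compressions by a free idempotent of free algebras are free. -/
theorem IsFreeFamily.compress {ι : Type*} {e : ι → κ} (he : Function.Injective e) (h1 : φ 1 = 1)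
    (hp : IsIdempotentElem p) (hfree : IsFreeFamily φ fun i => (𝒞 i : Set B)) (hpo : p ∈ 𝒞 o)
    (heo : ∀ i, e i ≠ o) (hα : IsUnit (φ p)) :
    IsFreeFamily φ fun i : ι => (cornerSpan φ p (𝒞 (e i)) : Set B) := by
  -- Vanishing alone does not pass through products; membership in the span of compressed words
  -- does.
  suffices ∀ i j x, AltWord φ (fun i : ι => (cornerSpan φ p (𝒞 (e i)) : Set B)) i j x →
      x ∈ compressedWords φ p 𝒞 (e i) (e j) from
    fun i j x hx => map_compressedWords h1 hfree hpo (heo i) (heo j) (this i j x hx)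
  intro i j x hx
  induction hx with
  | letter ha h0 => exact mem_compressedWords_of_map_eq_zero h1 hfree hpo hα (heo _) ha h0
  | cons ha h0 hne _ ih =>
    exact mul_mem_compressedWords h1 hp hpo (heo _) (heo _) (he.ne hne)
      (mem_compressedWords_of_map_eq_zero h1 hfree hpo hα (heo _) ha h0) ih

end Compression

/-! ### The mirror formula as the value of `φ` on a Leibniz sum. -/

section Mirror

variable {κ R A : Type*} [CommRing R] [Ring A] [Algebra R A]

/-- The product of the letters of a list of indexed letters. -/
def letterProd (l : List (κ × A)) : A := (l.map Prod.snd).prod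

@[simp] theorem letterProd_nil : letterProd ([] : List (κ × A)) = 1 := rfl

@[simp] theorem letterProd_cons (x : κ × A) (l : List (κ × A)) :
    letterProd (x :: l) = x.2 * letterProd l := by simp [letterProd]

@[simp] theorem letterProd_append (l m : List (κ × A)) :
    letterProd (l ++ m) = letterProd l * letterProd m := by simp [letterProd]

/-- Lists of indexed `φ`-centred letters from `𝒞`, neighbouring indices being distinct. -/
def IsAlternating (φ : A →ₗ[R] R) (𝒞 : κ → Subalgebra R A) (l : List (κ × A)) : Prop :=
  l.IsChain (fun x y => x.1 ≠ y.1) ∧ ∀ x ∈ l, x.2 ∈ 𝒞 x.1 ∧ φ x.2 = 0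

variable {φ : A →ₗ[R] R} {𝒞 : κ → Subalgebra R A}

theorem IsAlternating.tail {x : κ × A} {l : List (κ × A)} (h : IsAlternating φ 𝒞 (x :: l)) :
    IsAlternating φ 𝒞 l :=
  ⟨h.1.tail, fun y hy => h.2 y (List.mem_cons_of_mem _ hy)⟩

theorem IsAlternating.replace_head {i : κ} {a b : A} {l : List (κ × A)}
    (h : IsAlternating φ 𝒞 ((i, a) :: l)) (hb : b ∈ 𝒞 i) (h0 : φ b = 0) :
    IsAlternating φ 𝒞 ((i, b) :: l) := by
  refine ⟨List.isChain_cons.2 (List.isChain_cons.1 h.1), fun x hx => ?_⟩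
  rcases List.mem_cons.1 hx with rfl | hx
  · exact ⟨hb, h0⟩
  · exact h.tail.2 x hx

theorem IsAlternating.reverse {l : List (κ × A)} (h : IsAlternating φ 𝒞 l) :
    IsAlternating φ 𝒞 l.reverse :=
  ⟨List.isChain_reverse.2 (h.1.imp fun _ _ hne => hne.symm),
    fun x hx => h.2 x (List.mem_reverse.1 hx)⟩

theorem IsAlternating.append {l m : List (κ × A)} (hl : IsAlternating φ 𝒞 l)
    (hm : IsAlternating φ 𝒞 m) (h : ∀ x ∈ l.getLast?, ∀ y ∈ m.head?, x.1 ≠ y.1) :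
    IsAlternating φ 𝒞 (l ++ m) :=
  ⟨List.isChain_append.2 ⟨hl.1, hm.1, h⟩,
    fun x hx => (List.mem_append.1 hx).elim (hl.2 x) (hm.2 x)⟩

theorem IsAlternating.of_append_left {l m : List (κ × A)} (h : IsAlternating φ 𝒞 (l ++ m)) :
    IsAlternating φ 𝒞 l :=
  ⟨(List.isChain_append.1 h.1).1, fun x hx => h.2 x (List.mem_append_left _ hx)⟩

theorem IsAlternating.of_append_right {l m : List (κ × A)} (h : IsAlternating φ 𝒞 (l ++ m)) :
    IsAlternating φ 𝒞 m :=
  ⟨(List.isChain_append.1 h.1).2.1, fun x hx => h.2 x (List.mem_append_right _ hx)⟩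

theorem IsAlternating.exists_altWord {x : κ × A} {l : List (κ × A)}
    (h : IsAlternating φ 𝒞 (x :: l)) :
    ∃ j, AltWord φ (fun i => (𝒞 i : Set A)) x.1 j (letterProd (x :: l)) := by
  induction l generalizing x with
  | nil =>
    obtain ⟨h1, h2⟩ := h.2 x (by simp)
    exact ⟨x.1, by simpa using AltWord.letter (𝒞 := fun i => (𝒞 i : Set A)) h1 h2⟩
  | cons y l ih =>
    obtain ⟨j, hj⟩ := ih h.tail
    obtain ⟨h1, h2⟩ := h.2 x (by simp)
    exact ⟨j, by
      rw [letterProd_cons]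
      exact .cons h1 h2 (List.isChain_cons_cons.1 h.1).1 hj⟩

theorem AltWord.exists_list {i j : κ} {w : A}
    (h : AltWord φ (fun i => (𝒞 i : Set A)) i j w) :
    ∃ a l, IsAlternating φ 𝒞 ((i, a) :: l) ∧ w = letterProd ((i, a) :: l) := by
  induction h with
  | @letter i a ha h0 => exact ⟨a, [], ⟨by simp, by simpa using ⟨ha, h0⟩⟩, by simp⟩
  | @cons i j k a w ha h0 hne _ ih =>
    obtain ⟨b, l, hl, rfl⟩ := ih
    refine ⟨a, (j, b) :: l, ⟨List.isChain_cons_cons.2 ⟨hne, hl.1⟩, fun x hx => ?_⟩, by simp⟩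
    rcases List.mem_cons.1 hx with rfl | hx
    · exact ⟨ha, h0⟩
    · exact hl.2 x hx

theorem IsAlternating.map_eq_zero (hfree : IsFreeFamily φ fun i => (𝒞 i : Set A))
    {l : List (κ × A)} (h : IsAlternating φ 𝒞 l) (hl : l ≠ []) : φ (letterProd l) = 0 := by
  cases l with
  | nil => exact absurd rfl hl
  | cons x l => obtain ⟨j, hj⟩ := h.exists_altWord; exact hfree hj

/-- The sum over the letters of a word of the value of `f` at that letter times the product of
the other letters. -/
def leibnizSum (f : A →ₗ[R] R) : List (κ × A) → A
  | [] => 0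
  | x :: l => f x.2 • letterProd l + x.2 * leibnizSum f l

theorem leibnizSum_eq_sum (f : A →ₗ[R] R) (l : List (κ × A)) :
    leibnizSum f l = ∑ m : Fin l.length,
      f l[m].2 • (letterProd (l.take m) * letterProd (l.drop (m + 1))) := by
  induction l with
  | nil => rfl
  | cons x l ih =>
    rw [leibnizSum, ih]
    refine Eq.trans ?_ (Fin.sum_univ_succ (n := l.length) _).symm
    simp [Finset.mul_sum, mul_assoc]

variable [DecidableEq κ]

/-- In a free family, the value of a product of two alternating words: letters are paired off from
the middle outwards. -/
theorem map_reverse_mul (h1 : φ 1 = 1) (hfree : IsFreeFamily φ fun i => (𝒞 i : Set A))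
    {u v : List (κ × A)} (hu : IsAlternating φ 𝒞 u) (hv : IsAlternating φ 𝒞 v) :
    φ (letterProd u.reverse * letterProd v) =
      if u.map Prod.fst = v.map Prod.fst then
        (List.zipWith (fun x y => φ (x.2 * y.2)) u v).prod else 0 := by
  induction u generalizing v with
  | nil =>
    cases v with
    | nil => simp [h1]
    | cons y v => simpa using hv.map_eq_zero hfree (by simp)
  | cons x u ih =>
    cases v with
    | nil => simpa using hu.reverse.map_eq_zero hfree (by simp)
    | cons y v =>
      obtain ⟨i, a⟩ := x
      obtain ⟨j, b⟩ := y
      by_cases hij : i = j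
      · subst hij
        have hab : a * b ∈ 𝒞 i := mul_mem (hu.2 (i, a) (by simp)).1 (hv.2 (i, b) (by simp)).1
        -- Once the two meeting letters are merged and centred, the whole word alternates; only the
        -- scalar `φ (a * b)` survives, times the product of the remaining words.
        have h0 : φ (letterProd (u.reverse ++ (i, centred φ (a * b)) :: v)) = 0 := by
          refine IsAlternating.map_eq_zero hfree (hu.tail.reverse.append
            (hv.replace_head (centred_mem hab) (map_centred h1 _)) ?_) (by simp)
          intro x hx y hy
          obtain rfl : (i, centred φ (a * b)) = y := by simpa using hy
          exact ((List.isChain_cons.1 hu.1).1 x (by simpa using hx)).symm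
        have h : letterProd ((i, a) :: u).reverse * letterProd ((i, b) :: v) =
            φ (a * b) • (letterProd u.reverse * letterProd v) +
              letterProd (u.reverse ++ (i, centred φ (a * b)) :: v) := by
          simp [centred, mul_assoc, mul_sub, sub_mul]
        rw [h, map_add, h0, add_zero, map_smul, ih hu.tail hv.tail]
        simp
      · rw [← letterProd_append, IsAlternating.map_eq_zero hfree (hu.reverse.append hv ?_) (by simp)]
        · simp [hij]
        · intro x hx y hy
          obtain rfl : (i, a) = x := by simpa using hx
          obtain rfl : (j, b) = y := by simpa using hy
          exact hij

theorem map_leibnizSum (h1 : φ 1 = 1) (hfree : IsFreeFamily φ fun i => (𝒞 i : Set A))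
    (f : A →ₗ[R] R) {l : List (κ × A)} (hl : IsAlternating φ 𝒞 l) :
    φ (leibnizSum f l) = ∑ m : Fin l.length, f l[m].2 *
      if (l.take m).reverse.map Prod.fst = (l.drop (m + 1)).map Prod.fst then
        (List.zipWith (fun x y => φ (x.2 * y.2)) (l.take m).reverse (l.drop (m + 1))).prod
      else 0 := by
  rw [leibnizSum_eq_sum, map_sum]
  refine Finset.sum_congr rfl fun m _ => ?_
  have hs : IsAlternating φ 𝒞 (l.take m) :=
    IsAlternating.of_append_left (m := l.drop m) (by rwa [List.take_append_drop])
  have ht : IsAlternating φ 𝒞 (l.drop (m + 1)) :=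
    IsAlternating.of_append_right (l := l.take (m + 1)) (by rwa [List.take_append_drop])
  rw [map_smul, smul_eq_mul, ← map_reverse_mul h1 hfree hs.reverse ht, List.reverse_reverse]

/-- Pairing off requires equally many letters on both sides of the deleted one, so only the middle
letter of an odd word contributes. -/
theorem map_leibnizSum_ofFn (h1 : φ 1 = 1) (hfree : IsFreeFamily φ fun i => (𝒞 i : Set A))
    (f : A →ₗ[R] R) {n : ℕ} (hn : 0 < n) (i : Fin n → κ) (a : Fin n → A)
    (hl : IsAlternating φ 𝒞 (List.ofFn fun j => (i j, a j))) :
    φ (leibnizSum f (List.ofFn fun j => (i j, a j))) =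
      if Odd n ∧ ∀ j, i j = i j.rev then
        (∏ j : Fin (n / 2),
          φ (a (Fin.castLE (Nat.div_le_self n 2) j) *
            a (Fin.castLE (Nat.div_le_self n 2) j).rev)) *
          f (a ⟨n / 2, Nat.div_lt_self hn one_lt_two⟩)
      else 0 := by
  rw [map_leibnizSum h1 hfree f hl]
  set l := List.ofFn fun j => (i j, a j) with hldef
  have hlen : l.length = n := by simp [hldef]
  have hget : ∀ (m : ℕ) (hm : m < l.length),
      l[m] = (i ⟨m, hlen ▸ hm⟩, a ⟨m, hlen ▸ hm⟩) := by simp [hldef]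
  by_cases hodd : Odd n
  · obtain ⟨r, hr⟩ := hodd
    have hr2 : n / 2 = r := by omega
    rw [Finset.sum_eq_single ⟨n / 2, by omega⟩]
    · have hiff : ((l.take (n / 2)).reverse.map Prod.fst = (l.drop (n / 2 + 1)).map Prod.fst) ↔
          ∀ j, i j = i j.rev := by
        constructor
        · intro h
          -- `t` counts the distance from the middle position `r`, starting with its immediate
          -- neighbours.
          have key : ∀ t (ht : t < r), i ⟨r - 1 - t, by omega⟩ = i ⟨r + 1 + t, by omega⟩ := by
            intro t ht
            have h' := List.getElem_of_eq h (i := t) (by simp; omega)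
            simpa [hget, hr2, hlen, show min r n = r by omega] using h'
          intro j
          rcases lt_trichotomy j.1 r with hj | hj | hj
          · convert key (r - 1 - j.1) (by omega) using 2
            · ext; simp; omega
            · ext; simp; omega
          · congr 1; ext; simp; omega
          · convert (key (j.1 - r - 1) (by omega)).symm using 2
            · ext; simp; omega
            · ext; simp; omega
        · intro h
          refine List.ext_getElem (by simp; omega) fun t h₁ h₂ => ?_
          have ht : t < r := by simp at h₁; omega
          have h' := h ⟨r - 1 - t, by omega⟩
          simp only [List.getElem_map, List.getElem_reverse, List.getElem_take, List.getElem_drop,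
            hget, List.length_take]
          convert h' using 2
          · ext; simp; omega
          · ext; simp; omega
      have hprod : (List.zipWith (fun x y => φ (x.2 * y.2)) (l.take (n / 2)).reverse
          (l.drop (n / 2 + 1))).prod = ∏ j : Fin (n / 2),
          φ (a (Fin.castLE (Nat.div_le_self n 2) j) *
            a (Fin.castLE (Nat.div_le_self n 2) j).rev) := by
        -- The zipped list runs from the middle outwards, the product over `Fin (n / 2)` from the
        -- ends inwards.
        rw [← List.prod_ofFn, ← List.prod_reverse]
        congr 1
        refine List.ext_getElem (by simp; omega) fun t h₁ h₂ => ?_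
        have ht : t < r := by simpa [hr2] using h₂
        simp only [List.getElem_reverse, List.getElem_zipWith, List.getElem_take,
          List.getElem_drop, hget, List.getElem_ofFn, List.length_zipWith, List.length_reverse,
          List.length_take, List.length_drop]
        congr 3
        · ext; simp; omega
        · ext; simp; omega
      simp only [hiff, hprod, Fin.getElem_fin, hget]
      simp only [show Odd n from ⟨r, hr⟩, true_and]
      split_ifs
      · rw [mul_comm]
      · rw [mul_zero]
    · intro m _ hm
      rw [if_neg, mul_zero]
      intro h
      have := congrArg List.length h
      simp only [List.length_map, List.length_reverse, List.length_take, List.length_drop] at this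
      have h2 := m.2
      exact hm (Fin.ext (by simp only; omega))
    · simp
  · rw [if_neg (fun h => hodd h.1)]
    refine Finset.sum_eq_zero fun m _ => ?_
    rw [if_neg, mul_zero]
    intro h
    have := congrArg List.length h
    simp only [List.length_map, List.length_reverse, List.length_take, List.length_drop] at this
    have h2 := m.2
    exact hodd ⟨m.1, by omega⟩

end Mirror

/-! ### Infinitesimal freeness as freeness over the dual numbers. -/

namespace Incps

open TrivSqZeroExt

section Dual

variable {A : Type*} [Ring A] [Algebra ℂ A] {k : ℕ}

/-- The functional `φ + ε φ'` on `A[ε]`, with values in `ℂ[ε]`. -/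
noncomputable def dual (S : Incps A) (x : DualNumber A) : DualNumber ℂ :=
  inl (S.φ x.fst) + inr (S.φ' x.fst + S.φ x.snd)

theorem dual_eq_zero_iff {S : Incps A} {x : DualNumber A} :
    S.dual x = 0 ↔ S.φ x.fst = 0 ∧ S.φ' x.fst + S.φ x.snd = 0 := by
  simp [dual, TrivSqZeroExt.ext_iff]

variable {S : Incps A} {𝒜 : Fin k → Subalgebra ℂ A}

theorem InfFree.map_letterProd (h : S.InfFree 𝒜) {l : List (Fin k × A)}
    (hl : IsAlternating S.φ 𝒜 l) (hne : l ≠ []) :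
    S.φ (letterProd l) = 0 ∧ S.φ' (letterProd l) =
      if Odd l.length ∧ ∀ j, (l.get j).1 = (l.get j.rev).1 then
        (∏ j : Fin (l.length / 2),
          S.φ ((l.get (Fin.castLE (Nat.div_le_self _ 2) j)).2 *
            (l.get (Fin.castLE (Nat.div_le_self _ 2) j).rev).2)) *
          S.φ' (l.get ⟨l.length / 2,
            Nat.div_lt_self (List.length_pos_of_ne_nil hne) one_lt_two⟩).2
      else 0 := by
  have h' := h l.length (List.length_pos_of_ne_nil hne) (fun j => (l.get j).1)
    (fun j => (l.get j).2) (fun j hj => List.isChain_iff_getElem.1 hl.1 j hj)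
    (fun j => (hl.2 _ (l.get_mem j)).1) (fun j => (hl.2 _ (l.get_mem j)).2)
  have hprod : (List.ofFn fun j => (l.get j).2).prod = letterProd l := by
    rw [letterProd]
    congr 1
    exact List.ext_getElem (by simp) (by simp)
  rwa [hprod] at h'

theorem InfFree.isFreeFamily (h : S.InfFree 𝒜) :
    IsFreeFamily S.φ fun i => (𝒜 i : Set A) := by
  intro i j w hw
  obtain ⟨a, l, hl, rfl⟩ := hw.exists_list
  exact (h.map_letterProd hl (by simp)).1

theorem InfFree.map_leibnizSum (h : S.InfFree 𝒜) {l : List (Fin k × A)}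
    (hl : IsAlternating S.φ 𝒜 l) (hne : l ≠ []) :
    S.φ' (letterProd l) = S.φ (leibnizSum S.φ' l) := by
  have hof : (List.ofFn fun j => ((l.get j).1, (l.get j).2)) = l :=
    List.ext_getElem (by simp) (by simp)
  have h2 := map_leibnizSum_ofFn S.φ_one h.isFreeFamily S.φ' (List.length_pos_of_ne_nil hne)
    (fun j => (l.get j).1) (fun j => (l.get j).2) (by rwa [hof])
  rw [hof] at h2
  rw [h2]
  exact (h.map_letterProd hl hne).2

/-- A letter `a + ε b` is centred iff `φ a = 0` and `b + φ'(a)` is centred. Adding the Leibniz sum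
to the `ε`-part of a product therefore replaces one letter at a time by a centred one. -/
theorem AltWord.exists_dual_list {i j : Fin k} {x : DualNumber A}
    (hx : AltWord S.dual (fun i => {x | x.fst ∈ 𝒜 i ∧ x.snd ∈ 𝒜 i}) i j x) :
    ∃ a l, IsAlternating S.φ 𝒜 ((i, a) :: l) ∧ x.fst = letterProd ((i, a) :: l) ∧
      x.snd + leibnizSum S.φ' ((i, a) :: l) ∈
        Submodule.span ℂ {w | ∃ j, AltWord S.φ (fun i => (𝒜 i : Set A)) i j w} := by
  induction hx with
  | @letter i x hx h0 =>
    obtain ⟨h1, h2⟩ := dual_eq_zero_iff.1 h0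
    refine ⟨x.fst, [], ⟨by simp, by simpa using ⟨hx.1, h1⟩⟩, by simp, Submodule.subset_span
      ⟨i, .letter ?_ ?_⟩⟩
    · simpa [leibnizSum] using add_mem hx.2 ((𝒜 i).smul_mem (𝒜 i).one_mem _)
    · simpa [leibnizSum, S.φ_one, add_comm] using h2
  | @cons i j k x y hx h0 hne _ ih =>
    obtain ⟨b, l, hl, hfst, hsnd⟩ := ih
    obtain ⟨h1, h2⟩ := dual_eq_zero_iff.1 h0
    have hxl : IsAlternating S.φ 𝒜 ((i, x.fst) :: (j, b) :: l) := by
      refine ⟨List.isChain_cons_cons.2 ⟨hne, hl.1⟩, fun z hz => ?_⟩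
      rcases List.mem_cons.1 hz with rfl | hz
      · exact ⟨hx.1, h1⟩
      · exact hl.2 z hz
    refine ⟨x.fst, (j, b) :: l, hxl, by simp [hfst], ?_⟩
    have key : (x * y).snd + leibnizSum S.φ' ((i, x.fst) :: (j, b) :: l) =
        x.fst * (y.snd + leibnizSum S.φ' ((j, b) :: l)) +
          (x.snd + S.φ' x.fst • 1) * letterProd ((j, b) :: l) := by
      rw [leibnizSum, snd_mul, hfst]
      simp only [smul_eq_mul, MulOpposite.smul_eq_mul_unop, MulOpposite.unop_op, mul_add, add_mul,
        smul_mul_assoc, one_mul]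
      abel
    rw [key]
    refine add_mem ?_ (Submodule.subset_span ?_)
    · have hle : Submodule.span ℂ {w | ∃ l, AltWord S.φ (fun i => (𝒜 i : Set A)) j l w} ≤
          (Submodule.span ℂ {w | ∃ l, AltWord S.φ (fun i => (𝒜 i : Set A)) i l w}).comap
            (LinearMap.mulLeft ℂ x.fst) := by
        refine Submodule.span_le.2 ?_
        rintro w ⟨m, hw⟩
        exact Submodule.subset_span ⟨m, .cons hx.1 h1 hne hw⟩
      exact hle hsnd
    · obtain ⟨m, hm⟩ := hl.exists_altWord
      refine ⟨m, .cons (add_mem hx.2 ((𝒜 i).smul_mem (𝒜 i).one_mem _)) ?_ hne hm⟩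
      simpa [S.φ_one, add_comm] using h2

/-- Infinitesimal freeness implies freeness over the dual numbers. -/
theorem InfFree.dual (h : S.InfFree 𝒜) :
    IsFreeFamily S.dual fun i => {x | x.fst ∈ 𝒜 i ∧ x.snd ∈ 𝒜 i} := by
  intro i j x hx
  obtain ⟨a, l, hl, hfst, hsnd⟩ := AltWord.exists_dual_list hx
  have hle : Submodule.span ℂ {w | ∃ j, AltWord S.φ (fun i => (𝒜 i : Set A)) i j w} ≤
      LinearMap.ker S.φ := by
    refine Submodule.span_le.2 ?_
    rintro w ⟨m, hw⟩
    exact h.isFreeFamily hw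
  have h0 : S.φ (x.snd + leibnizSum S.φ' ((i, a) :: l)) = 0 := hle hsnd
  rw [dual_eq_zero_iff, hfst, h.map_leibnizSum hl (by simp)]
  refine ⟨(h.map_letterProd hl (by simp)).1, ?_⟩
  rwa [map_add, add_comm] at h0

/-- Freeness over the dual numbers of elements of the form `a + ε c` implies infinitesimal
freeness. -/
theorem InfFree.of_dual {𝒢 : Fin k → Set (DualNumber A)}
    (h𝒢 : ∀ i, ∀ a ∈ 𝒜 i, ∀ c : ℂ, (inl a + inr (c • 1) : DualNumber A) ∈ 𝒢 i)
    (h : IsFreeFamily S.dual 𝒢) : S.InfFree 𝒜 := by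
  -- The product of the lifts `a - ε φ'(a)` has `ε`-part minus the Leibniz sum.
  have key : ∀ (l : List (Fin k × A)) (x : Fin k × A), IsAlternating S.φ 𝒜 (x :: l) →
      ∃ j, AltWord S.dual 𝒢 x.1 j
        (inl (letterProd (x :: l)) - inr (leibnizSum S.φ' (x :: l)) : DualNumber A) := by
    intro l
    have hletter : ∀ (x : Fin k × A), x.2 ∈ 𝒜 x.1 ∧ S.φ x.2 = 0 →
        (inl x.2 + inr ((-S.φ' x.2) • 1) : DualNumber A) ∈ 𝒢 x.1 ∧
        S.dual (inl x.2 + inr ((-S.φ' x.2) • 1)) = 0 := fun x hx =>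
      ⟨h𝒢 _ _ hx.1 _, dual_eq_zero_iff.2 (by simp [hx.2, S.φ_one])⟩
    induction l with
    | nil =>
      intro x hx
      obtain ⟨h1, h2⟩ := hletter x (hx.2 x (by simp))
      refine ⟨x.1, ?_⟩
      convert AltWord.letter h1 h2 using 1
      ext <;> simp [leibnizSum]
    | cons y l ih =>
      intro x hx
      obtain ⟨h1, h2⟩ := hletter x (hx.2 x (by simp))
      obtain ⟨j, hj⟩ := ih y hx.tail
      refine ⟨j, ?_⟩
      convert AltWord.cons h1 h2 (List.isChain_cons_cons.1 hx.1).1 hj using 1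
      ext
      · simp
      · rw [leibnizSum]
        simp
  have hzero : ∀ l : List (Fin k × A), l ≠ [] → IsAlternating S.φ 𝒜 l →
      S.φ (letterProd l) = 0 ∧ S.φ' (letterProd l) = S.φ (leibnizSum S.φ' l) := by
    intro l hne hl
    obtain ⟨x, l, rfl⟩ := List.exists_cons_of_ne_nil hne
    obtain ⟨j, hj⟩ := key l x hl
    simpa [dual_eq_zero_iff, sub_eq_zero, ← sub_eq_add_neg] using h hj
  have hfree : IsFreeFamily S.φ fun i => (𝒜 i : Set A) := by
    intro i j w hw
    obtain ⟨a, l, hl, rfl⟩ := hw.exists_list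
    exact (hzero _ (by simp) hl).1
  intro n hn i a hi ha h0
  have hl : IsAlternating S.φ 𝒜 (List.ofFn fun j => (i j, a j)) := by
    refine ⟨List.isChain_iff_getElem.2 fun j hj => ?_, fun x hx => ?_⟩
    · simpa using hi j (by simpa using hj)
    · obtain ⟨j, rfl⟩ := (List.mem_ofFn' _ _).1 hx
      exact ⟨ha j, h0 j⟩
  have hprod : (List.ofFn a).prod = letterProd (List.ofFn fun j => (i j, a j)) := by
    rw [letterProd, List.map_ofFn]
    rfl
  obtain ⟨h1, h2⟩ := hzero _ (by simpa using hn.ne') hl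
  rw [hprod]
  exact ⟨h1, h2.trans (map_leibnizSum_ofFn S.φ_one hfree S.φ' hn i a hl)⟩

end Dual

end Incps

/-! ### `A[ε]` as an algebra over `ℂ[ε]`. -/

namespace Incps

open TrivSqZeroExt

section DualAlgebra

variable {A : Type*} [Ring A] [Algebra ℂ A]

variable (A) in
/-- The map `ℂ[ε] → A[ε]` induced by the structure map `ℂ → A`. -/
noncomputable def dualAlgebraMap : DualNumber ℂ →+* DualNumber A where
  toFun c := inl (algebraMap ℂ A c.fst) + inr (c.snd • 1)
  map_one' := by ext <;> simp
  map_zero' := by ext <;> simp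
  map_mul' c d := by
    ext
    · simp
    · simp [Algebra.algebraMap_eq_smul_one, smul_smul, add_smul, mul_comm]
  map_add' c d := by
    ext
    · simp
    · simp [add_smul]

theorem fst_dualAlgebraMap (c : DualNumber ℂ) :
    (dualAlgebraMap A c).fst = algebraMap ℂ A c.fst := by simp [dualAlgebraMap]

theorem snd_dualAlgebraMap (c : DualNumber ℂ) :
    (dualAlgebraMap A c).snd = algebraMap ℂ A c.snd := by
  simp [dualAlgebraMap, Algebra.algebraMap_eq_smul_one]

/-- The ring `A[ε]` is an algebra over `ℂ[ε]`. -/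
noncomputable instance (priority := low) dualAlgebra : Algebra (DualNumber ℂ) (DualNumber A) :=
  (dualAlgebraMap A).toAlgebra' fun c x => by
    ext
    · rw [fst_mul, fst_mul, fst_dualAlgebraMap, Algebra.commutes]
    · rw [snd_mul, snd_mul, fst_dualAlgebraMap, snd_dualAlgebraMap]
      simp only [smul_eq_mul, MulOpposite.smul_eq_mul_unop, MulOpposite.unop_op]
      rw [Algebra.commutes, Algebra.commutes c.snd, add_comm]

theorem dual_smul_fst (c : DualNumber ℂ) (x : DualNumber A) :
    (c • x).fst = c.fst • x.fst := by
  change (dualAlgebraMap A c * x).fst = _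
  rw [fst_mul, fst_dualAlgebraMap, Algebra.smul_def]

theorem dual_smul_snd (c : DualNumber ℂ) (x : DualNumber A) :
    (c • x).snd = c.fst • x.snd + c.snd • x.fst := by
  change (dualAlgebraMap A c * x).snd = _
  rw [snd_mul, fst_dualAlgebraMap, snd_dualAlgebraMap, Algebra.smul_def, Algebra.smul_def,
    smul_eq_mul, MulOpposite.smul_eq_mul_unop, MulOpposite.unop_op]

/-- The functional `φ + ε φ'` is linear over `ℂ[ε]`. -/
noncomputable def dualLinear (S : Incps A) : DualNumber A →ₗ[DualNumber ℂ] DualNumber ℂ where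
  toFun := S.dual
  map_add' x y := by
    ext
    · simp [dual]
    · simp [dual]
      ring
  map_smul' c x := by
    ext
    · simp [dual, dual_smul_fst]
    · simp [dual, dual_smul_fst, dual_smul_snd]
      ring

/-- The subalgebra `C[ε]` of `A[ε]`. -/
def dualSubalgebra (C : Subalgebra ℂ A) : Subalgebra (DualNumber ℂ) (DualNumber A) where
  carrier := {x | x.fst ∈ C ∧ x.snd ∈ C}
  mul_mem' {x y} hx hy := by
    refine ⟨?_, ?_⟩
    · simpa using mul_mem hx.1 hy.1
    · simpa using add_mem (mul_mem hx.1 hy.2) (mul_mem hx.2 hy.1)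
  add_mem' hx hy := ⟨add_mem hx.1 hy.1, add_mem hx.2 hy.2⟩
  algebraMap_mem' c := by
    rw [Algebra.algebraMap_eq_smul_one]
    refine ⟨?_, ?_⟩
    · simpa [dual_smul_fst] using C.smul_mem C.one_mem c.fst
    · simpa [dual_smul_snd] using C.smul_mem C.one_mem c.snd

theorem isUnit_of_fst_ne_zero {c : DualNumber ℂ} (hc : c.fst ≠ 0) : IsUnit c :=
  isUnit_iff_isUnit_fst.2 hc.isUnit

end DualAlgebra

/-! ### Passing between the corner and the ambient algebra. -/

section Corner

variable {A : Type*} [Ring A] {p : A} (hp : IsIdempotentElem p)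

/-- The inclusion of `(p A p)[ε]` into `A[ε]`. -/
def dualIncl (x : DualNumber hp.Corner) : DualNumber A := inl x.fst.1 + inr x.snd.1

theorem dualIncl_mul (x y : DualNumber hp.Corner) :
    dualIncl hp (x * y) = dualIncl hp x * dualIncl hp y := by
  ext
  · simp [dualIncl]
    rfl
  · simp [dualIncl]
    rfl

variable [Algebra ℂ A] {S : Incps A} {hp}

/-- The two functionals differ by the factor `(α + ε α')⁻¹ = 1/α - ε α'/α²`. Freeness depends only
on which elements are centred. -/
theorem dual_dualIncl_eq_zero_iff (hα : S.φ p ≠ 0) {x : DualNumber hp.Corner} :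
    S.dual (dualIncl hp x) = 0 ↔ (S.compression hp hα).dual x = 0 := by
  have hφ : ∀ b : hp.Corner, (S.compression hp hα).φ b = 1 / S.φ p * S.φ b.1 := fun _ => rfl
  have hφ' : ∀ b : hp.Corner, (S.compression hp hα).φ' b =
      1 / S.φ p * S.φ' b.1 - S.φ' p / S.φ p ^ 2 * S.φ b.1 := fun _ => rfl
  rw [dual_eq_zero_iff, dual_eq_zero_iff, hφ, hφ, hφ']
  simp only [dualIncl, fst_add, fst_inl, fst_inr, snd_add, snd_inl, snd_inr, add_zero, zero_add]
  constructor
  · rintro ⟨h1, h2⟩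
    rw [h1]
    exact ⟨mul_zero _, by rw [mul_zero, sub_zero, ← mul_add, h2, mul_zero]⟩
  · rintro ⟨h1, h2⟩
    have h1' : S.φ x.fst.1 = 0 := by simpa [hα] using h1
    rw [h1', mul_zero, sub_zero, ← mul_add] at h2
    exact ⟨h1', by simpa [hα] using h2⟩

theorem AltWord.dualIncl (hα : S.φ p ≠ 0) {ι : Type*} {M : ι → Set (DualNumber A)} {i j : ι}
    {x : DualNumber hp.Corner}
    (hx : AltWord (S.compression hp hα).dual (fun i => Incps.dualIncl hp ⁻¹' M i) i j x) :
    AltWord S.dual M i j (Incps.dualIncl hp x) := by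
  induction hx with
  | letter hx h0 => exact .letter hx ((dual_dualIncl_eq_zero_iff hα).2 h0)
  | cons hx h0 hne _ ih =>
    rw [dualIncl_mul]
    exact .cons hx ((dual_dualIncl_eq_zero_iff hα).2 h0) hne ih

theorem inl_mem_cornerSpan (X : Set A) {y : hp.Corner}
    (hy : y ∈ Algebra.adjoin ℂ (compressElt hp '' X)) :
    (inl y.1 : DualNumber A) ∈
      cornerSpan S.dualLinear (inl p) (dualSubalgebra (Algebra.adjoin ℂ X)) := by
  set M := cornerSpan S.dualLinear (inl p) (dualSubalgebra (Algebra.adjoin ℂ X))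
  have h1 : S.dualLinear 1 = 1 := by
    change S.dual 1 = 1
    ext <;> simp [dual, S.φ_one, S.φ'_one]
  have hpp : IsIdempotentElem (inl p : DualNumber A) := by
    rw [IsIdempotentElem, ← inl_mul, hp.eq]
  -- Stability of `M` under left multiplication is inherited by sums and products of such `y`, so
  -- `M` need not be shown to be an algebra; taking `m = p` recovers `y`.
  suffices ∀ m ∈ M, (inl y.1 : DualNumber A) * m ∈ M by
    have h := this _ self_mem_cornerSpan
    have hyp : y.1 * p = y.1 := congrArg Subtype.val (mul_one y)
    rwa [← inl_mul, hyp] at h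
  induction hy using Algebra.adjoin_induction with
  | mem y hy =>
    obtain ⟨x, hx, rfl⟩ := hy
    intro m hm
    have hx' : (inl x : DualNumber A) ∈ dualSubalgebra (Algebra.adjoin ℂ X) :=
      ⟨Algebra.subset_adjoin hx, zero_mem _⟩
    have := compress_mul_mem_cornerSpan h1 hpp hx' hm
    rwa [← inl_mul, ← inl_mul] at this
  | algebraMap c =>
    intro m hm
    have hpm : inl p * m = m := by
      induction hm using Submodule.span_induction with
      | mem x hx =>
        rcases hx with rfl | ⟨w, _, rfl⟩
        · exact hpp.eq
        · rw [← mul_assoc, ← mul_assoc, hpp.eq]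
      | zero => exact mul_zero _
      | add x y _ _ hx hy => rw [mul_add, hx, hy]
      | smul c x _ hx => rw [mul_smul_comm, hx]
    have hc : (inl (algebraMap ℂ hp.Corner c).1 : DualNumber A) * m =
        (inl c : DualNumber ℂ) • m := by
      have : (inl (algebraMap ℂ hp.Corner c).1 : DualNumber A) =
          (inl c : DualNumber ℂ) • inl p := by
        rw [Algebra.algebraMap_eq_smul_one]
        ext
        · rw [dual_smul_fst]; rfl
        · rw [dual_smul_snd]; simp
      rw [this, smul_mul_assoc, hpm]
    rw [hc]
    exact Submodule.smul_mem _ _ hm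
  | add y z _ _ hy hz =>
    intro m hm
    change inl (y.1 + z.1) * m ∈ M
    rw [inl_add, add_mul]
    exact add_mem (hy m hm) (hz m hm)
  | mul y z _ _ hy hz =>
    intro m hm
    change inl (y.1 * z.1) * m ∈ M
    rw [inl_mul, mul_assoc]
    exact hy _ (hz m hm)

end Corner

end Incps

/-! ### The compression theorem. -/

theorem corollary5p5 {A : Type*} [Ring A] [Algebra ℂ A] (S : Incps A) (p : A)
    (hp : IsIdempotentElem p) (hα : S.φ p ≠ 0) (k : ℕ) (X : Fin k → Set A)
    (hfree : S.InfFreeSets (Fin.cons {p} X : Fin (k + 1) → Set A)) :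
    (S.compression hp hα).InfFreeSets (fun i => Incps.compressElt hp '' X i) := by
  let 𝒞 : Fin (k + 1) → Subalgebra (DualNumber ℂ) (DualNumber A) := fun j =>
    Incps.dualSubalgebra (Algebra.adjoin ℂ ((Fin.cons {p} X : Fin (k + 1) → Set A) j))
  have h1 : S.dualLinear 1 = 1 := by
    change S.dual 1 = 1
    ext <;> simp [Incps.dual, S.φ_one, S.φ'_one]
  have hpp : IsIdempotentElem (TrivSqZeroExt.inl p : DualNumber A) := by
    rw [IsIdempotentElem, ← TrivSqZeroExt.inl_mul, hp.eq]
  have hpo : (TrivSqZeroExt.inl p : DualNumber A) ∈ 𝒞 0 :=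
    ⟨Algebra.subset_adjoin (by simp), zero_mem _⟩
  have hcomp : IsFreeFamily S.dual fun i : Fin k =>
      (cornerSpan S.dualLinear (TrivSqZeroExt.inl p) (𝒞 i.succ) : Set (DualNumber A)) :=
    IsFreeFamily.compress (φ := S.dualLinear) (𝒞 := 𝒞) (Fin.succ_injective k) h1 hpp hfree.dual
      hpo Fin.succ_ne_zero (Incps.isUnit_of_fst_ne_zero (by
        change (S.dual _).fst ≠ 0
        simpa [Incps.dual] using hα))
  refine Incps.InfFree.of_dual (𝒢 := fun i => Incps.dualIncl hp ⁻¹'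
    (cornerSpan S.dualLinear (TrivSqZeroExt.inl p) (𝒞 i.succ) : Set (DualNumber A))) ?_
    fun i j x hx => (Incps.dual_dualIncl_eq_zero_iff hα).1
      (hcomp (Incps.AltWord.dualIncl hα hx))
  intro i a ha c
  -- The unit of the corner is `p`, so the scalar `ε`-part becomes a multiple of `ε p`, which lies
  -- in the span.
  have hincl : Incps.dualIncl hp
      (TrivSqZeroExt.inl a + TrivSqZeroExt.inr (c • 1) : DualNumber hp.Corner) =
      TrivSqZeroExt.inl a.1 + (TrivSqZeroExt.inr c : DualNumber ℂ) • TrivSqZeroExt.inl p := by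
    ext
    · simp [Incps.dualIncl, Incps.dual_smul_fst]
    · simp [Incps.dualIncl, Incps.dual_smul_snd]
      rfl
  rw [Set.mem_preimage, hincl]
  exact add_mem (Incps.inl_mem_cornerSpan (X i) ha) (Submodule.smul_mem _ _ self_mem_cornerSpan)
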